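/- Let $\Gamma$ be a finite directed multigraph without loops (parallel arcs are allowed), each of whose arcs carries a positive real weight. A converging tree is a weakly connected digraph in which one vertex, the root, has outdegree $0$ and every other vertex has outdegree $1$. An in-forest of $\Gamma$ is a subgraph of $\Gamma$ that contains all vertices and all of whose weakly connected components are converging trees. The weight of an in-forest is the product of the weights of its arcs (equal to $1$ if it has no arcs). For vertices $i,j$, let $f_{ij}$ be the sum of the weights of all in-forests of $\Gamma$ in which $i$ belongs to a tree rooted at $j$ (equal to $0$ if there are none). Then for all vertices $i,j,k$ of $\Gamma$, $$f_{ij}\,f_{jk}\le f_{ik}\,f_{jj}.$$ Moreover, $f_{ij}\,f_{jk}=f_{ik}\,f_{jj}$ if and only if every directed path from $i$ to $k$ contains $j$. (A directed path has no repeated vertices; for $i=k$ the path of length zero, consisting of the vertex $i$ alone, is included.) -/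

import Mathlib

/-- A loopless weighted directed multigraph with vertex type `V` and arc type `E`.
Parallel arcs are allowed, and every arc carries a positive weight. -/
structure WeightedMultidigraph (V E : Type*) where
  tail : E → V
  head : E → V
  weight : E → ℝ
  weight_pos : ∀ e, 0 < weight e
  loopless : ∀ e, tail e ≠ head e

namespace WeightedMultidigraph

variable {V E : Type*} (G : WeightedMultidigraph V E)

/-- `H : Finset E` is the spanning subgraph of `G` with all vertices and the arcs in `H`.
`G.Step H u v` says that some arc of it goes from `u` to `v`. -/
def Step (H : Finset E) (u v : V) : Prop :=
  ∃ e ∈ H, G.tail e = u ∧ G.head e = v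

/-- The vertex set of the weakly connected component of `v` in the spanning subgraph `H`. -/
def weakComponent (H : Finset E) (v : V) : Set V :=
  {u | Relation.EqvGen (G.Step H) v u}

open Classical in
/-- The number of arcs of `H` that emanate from `v`. -/
noncomputable def outdegree (H : Finset E) (v : V) : ℕ :=
  (H.filter fun e => G.tail e = v).card

/-- The weakly connected component of `v` in `H` is a converging tree with root `r`: the
vertex `r` of the component has outdegree zero and its remaining vertices have outdegree one. -/
def InTreeRootedAt (H : Finset E) (v r : V) : Prop :=
  r ∈ G.weakComponent H v ∧ G.outdegree H r = 0 ∧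
    ∀ u ∈ G.weakComponent H v, u ≠ r → G.outdegree H u = 1

/-- In-forests: spanning subgraphs all of whose weakly connected components are
converging trees. -/
def IsInForest (H : Finset E) : Prop :=
  ∀ v, ∃ r, G.InTreeRootedAt H v r

/-- The weight of a subgraph, the product of the weights of its arcs. -/
noncomputable def subgraphWeight (H : Finset E) : ℝ :=
  ∏ e ∈ H, G.weight e

open Classical in
/-- The total weight `f i j` of all in-forests of `G` in which `i` belongs to a tree
rooted at `j`. -/
noncomputable def inForestWeight [Fintype E] (i j : V) : ℝ :=
  ∑ H : Finset E with G.IsInForest H ∧ G.InTreeRootedAt H i j, G.subgraphWeight H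

/-- Directed routes (walks) in `G`; the route of length zero is included. -/
inductive Route : V → V → Type _
  | nil (v : V) : Route v v
  | cons {u v w : V} (e : E) (htail : G.tail e = u) (hhead : G.head e = v)
      (p : Route v w) : Route u w

/-- The vertices of a route, in order, with repetitions. -/
def Route.vertices {G : WeightedMultidigraph V E} : {u w : V} → G.Route u w → List V
  | _, _, .nil v => [v]
  | u, _, .cons _ _ _ p => u :: p.vertices

/-- A directed path is a route without repeated vertices. -/
def Route.IsPath {G : WeightedMultidigraph V E} {u w : V} (p : G.Route u w) : Prop :=
  p.vertices.Nodup

end WeightedMultidigraph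

/-! Write `F` for the total in-forest weight and `L` for the weighted Laplacian.
`inForestWeight_add_sum` gives `(1 + L) f(·,k) = F · 1_k`. Hence `g v = f(v,k) f(j,j) - f(v,j)
f(j,k)` vanishes at `j`, and off `j` it satisfies `(1 + L) g = F f(j,j) 1_k`, whose right side is
nonnegative. The minimum principle `nonneg_of_superharmonic` yields `g ≥ 0`, the inequality. If `g i
= 0`, zeros spread along arcs until `j` is met, and `k ≠ j` is never a zero, so every route to `k`
meets `j`. Conversely, on the vertices all of whose routes to `k` meet `j`, the equation off `j` is
homogeneous, and the minimum principle for `-g` forces `g = 0`. -/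

namespace WeightedMultidigraph

variable {V E : Type*} (G : WeightedMultidigraph V E)

/-! ### In-forests as functional digraphs -/

/-- `r` is a sink of `H` that can be reached from `v` along arcs of `H`. -/
def ReachesSink (H : Finset E) (v r : V) : Prop :=
  Relation.ReflTransGen (G.Step H) v r ∧ ∀ e ∈ H, G.tail e ≠ r

/-- Distinct arcs of `H` have distinct tails. -/
def IsFunctional (H : Finset E) : Prop :=
  ∀ e ∈ H, ∀ e' ∈ H, G.tail e = G.tail e' → e = e'

variable {G}

theorem outdegree_eq_zero_iff {H : Finset E} {v : V} :
    G.outdegree H v = 0 ↔ ∀ e ∈ H, G.tail e ≠ v := by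
  simp [outdegree, Finset.filter_eq_empty_iff]

theorem isFunctional_iff_outdegree_le_one {H : Finset E} :
    G.IsFunctional H ↔ ∀ v, G.outdegree H v ≤ 1 := by
  simp only [outdegree, Finset.card_le_one, Finset.mem_filter]
  constructor
  · rintro h v a ⟨ha, rfl⟩ b ⟨hb, hab⟩
    exact h a ha b hb hab.symm
  · intro h e he e' he' hee
    exact h (G.tail e) e ⟨he, rfl⟩ e' ⟨he', hee.symm⟩

theorem IsFunctional.step_unique {H : Finset E} (hH : G.IsFunctional H) {u v w : V}
    (huv : G.Step H u v) (huw : G.Step H u w) : v = w := by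
  obtain ⟨e, he, rfl, rfl⟩ := huv
  obtain ⟨e', he', ht, rfl⟩ := huw
  rw [hH e he e' he' ht.symm]

theorem IsFunctional.mono {H H' : Finset E} (hH : G.IsFunctional H) (h : H' ⊆ H) :
    G.IsFunctional H' :=
  fun e he e' he' => hH e (h he) e' (h he')

theorem Step.mono {H H' : Finset E} (h : H ⊆ H') {u v : V} (huv : G.Step H u v) :
    G.Step H' u v := by
  obtain ⟨e, he, ht⟩ := huv
  exact ⟨e, h he, ht⟩

theorem reflTransGen_step_mono {H H' : Finset E} (h : H ⊆ H') {u v : V}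
    (huv : Relation.ReflTransGen (G.Step H) u v) : Relation.ReflTransGen (G.Step H') u v :=
  Relation.ReflTransGen.mono (fun _ _ => Step.mono h) _ _ huv

theorem eqvGen_step_of_reflTransGen {H : Finset E} {u v : V}
    (huv : Relation.ReflTransGen (G.Step H) u v) : Relation.EqvGen (G.Step H) u v := by
  induction huv with
  | refl => exact .refl _
  | tail _ h ih => exact .trans _ _ _ ih (.rel _ _ h)

theorem IsFunctional.reachesSink_of_step {H : Finset E} (hH : G.IsFunctional H) {u v r : V}
    (huv : G.Step H u v) (hu : G.ReachesSink H u r) : G.ReachesSink H v r := by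
  refine ⟨?_, hu.2⟩
  rcases hu.1.cases_head with rfl | ⟨w, huw, hw⟩
  · obtain ⟨e, he, ht, -⟩ := huv
    exact absurd ht (hu.2 e he)
  · rwa [hH.step_unique huv huw]

/-- With unique out-arcs, following or prepending an arc preserves the sink reached, so directed
reachability can replace weak connectivity. -/
theorem IsFunctional.reachesSink_congr {H : Finset E} (hH : G.IsFunctional H) {u v r : V}
    (huv : Relation.EqvGen (G.Step H) u v) : G.ReachesSink H u r ↔ G.ReachesSink H v r := by
  induction huv with
  | rel x y h => exact ⟨hH.reachesSink_of_step h, fun h' => ⟨.head h h'.1, h'.2⟩⟩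
  | refl x => rfl
  | symm x y _ ih => exact ih.symm
  | trans x y z _ _ ih₁ ih₂ => exact ih₁.trans ih₂

theorem ReachesSink.eq_of_sink {H : Finset E} {v r : V} (h : G.ReachesSink H v r)
    (hv : ∀ e ∈ H, G.tail e ≠ v) : v = r := by
  rcases h.1.cases_head with rfl | ⟨w, ⟨e, he, ht, -⟩, -⟩
  · rfl
  · exact absurd ht (hv e he)

theorem IsFunctional.reachesSink_unique {H : Finset E} (hH : G.IsFunctional H) {v r s : V}
    (hr : G.ReachesSink H v r) (hs : G.ReachesSink H v s) : r = s := by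
  have h : G.ReachesSink H r s := (hH.reachesSink_congr (eqvGen_step_of_reflTransGen hr.1)).1 hs
  exact h.eq_of_sink hr.2

theorem IsFunctional.inTreeRootedAt_iff {H : Finset E} (hH : G.IsFunctional H) {v r : V} :
    G.InTreeRootedAt H v r ↔ G.ReachesSink H v r := by
  constructor
  · rintro ⟨hr, h0, -⟩
    exact (hH.reachesSink_congr hr).2 ⟨.refl, outdegree_eq_zero_iff.1 h0⟩
  · intro h
    refine ⟨eqvGen_step_of_reflTransGen h.1, outdegree_eq_zero_iff.2 h.2, fun u hu hur => ?_⟩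
    have hle := isFunctional_iff_outdegree_le_one.1 hH u
    have hne : G.outdegree H u ≠ 0 := fun h0 =>
      hur (((hH.reachesSink_congr hu).1 h).eq_of_sink (outdegree_eq_zero_iff.1 h0))
    omega

theorem isInForest_iff {H : Finset E} :
    G.IsInForest H ↔ G.IsFunctional H ∧ ∀ v, ∃ r, G.ReachesSink H v r := by
  constructor
  · intro h
    have hH : G.IsFunctional H := isFunctional_iff_outdegree_le_one.2 fun v => by
      obtain ⟨r, -, h0, h1⟩ := h v
      by_cases hv : v = r
      · rw [hv, h0]; exact zero_le_one
      · exact (h1 v (.refl v) hv).le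
    exact ⟨hH, fun v => (h v).imp fun r => hH.inTreeRootedAt_iff.1⟩
  · rintro ⟨hH, h⟩ v
    exact (h v).imp fun r => hH.inTreeRootedAt_iff.2

/-- In an in-forest every vertex lies in a tree with exactly one root. -/
theorem IsInForest.exists_root {H : Finset E} (h : G.IsInForest H) :
    ∃ r : V → V, ∀ v k, G.InTreeRootedAt H v k ↔ r v = k := by
  obtain ⟨hH, hr⟩ := isInForest_iff.1 h
  choose r hr using hr
  refine ⟨r, fun v k => hH.inTreeRootedAt_iff.trans ⟨hH.reachesSink_unique (hr v), ?_⟩⟩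
  rintro rfl
  exact hr v

/-! ### Adding and deleting arcs -/

open Classical in
/-- Adding an arc from a root to a different tree gives an in-forest. -/
theorem IsInForest.insert {H : Finset E} (h : G.IsInForest H) {e : E}
    (hi : ∀ e' ∈ H, G.tail e' ≠ G.tail e) (he : ¬ G.InTreeRootedAt H (G.head e) (G.tail e)) :
    G.IsInForest (insert e H) ∧ ∀ v k, G.InTreeRootedAt (insert e H) v k ↔
      (G.InTreeRootedAt H v k ∧ k ≠ G.tail e) ∨
        (G.InTreeRootedAt H v (G.tail e) ∧ G.InTreeRootedAt H (G.head e) k) := by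
  obtain ⟨hH, hr⟩ := isInForest_iff.1 h
  simp only [hH.inTreeRootedAt_iff] at he ⊢
  have hH' : G.IsFunctional (Insert.insert e H) := by
    intro a ha b hb hab
    rw [Finset.mem_insert] at ha hb
    rcases ha with rfl | ha <;> rcases hb with rfl | hb
    · rfl
    · exact absurd hab.symm (hi b hb)
    · exact absurd hab (hi a ha)
    · exact hH a ha b hb hab
  have hsub : H ⊆ Insert.insert e H := Finset.subset_insert e H
  have mono : ∀ {v k}, G.ReachesSink H v k → k ≠ G.tail e →
      G.ReachesSink (Insert.insert e H) v k := by
    intro v k hv hk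
    refine ⟨reflTransGen_step_mono hsub hv.1, fun a ha => ?_⟩
    rcases Finset.mem_insert.1 ha with rfl | ha
    · exact hk.symm
    · exact hv.2 a ha
  have through : ∀ {v k}, G.ReachesSink H v (G.tail e) → G.ReachesSink H (G.head e) k →
      G.ReachesSink (Insert.insert e H) v k := by
    intro v k hv hk
    -- By `he` the head's root is not the tail of `e`, so it stays a sink and no cycle closes.
    have hk' := mono hk (by rintro rfl; exact he hk)
    refine ⟨?_, hk'.2⟩
    refine (reflTransGen_step_mono hsub hv.1).trans
      (.head ⟨e, Finset.mem_insert_self e H, rfl, rfl⟩ hk'.1)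
  have key : ∀ v, ∃ r, G.ReachesSink (Insert.insert e H) v r ∧
      ((G.ReachesSink H v r ∧ r ≠ G.tail e) ∨
        (G.ReachesSink H v (G.tail e) ∧ G.ReachesSink H (G.head e) r)) := by
    intro v
    obtain ⟨r, hv⟩ := hr v
    by_cases hre : r = G.tail e
    · obtain ⟨s, hs⟩ := hr (G.head e)
      subst hre
      exact ⟨s, through hv hs, .inr ⟨hv, hs⟩⟩
    · exact ⟨r, mono hv hre, .inl ⟨hv, hre⟩⟩
  refine ⟨isInForest_iff.2 ⟨hH', fun v => (key v).imp fun _ => And.left⟩, fun v k => ?_⟩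
  rw [hH'.inTreeRootedAt_iff]
  constructor
  · intro hk
    obtain ⟨r, h1, h2⟩ := key v
    rwa [hH'.reachesSink_unique hk h1]
  · rintro (⟨h1, h2⟩ | ⟨h1, h2⟩)
    · exact mono h1 h2
    · exact through h1 h2

open Classical in
/-- Deleting an arc of an in-forest makes its tail the root of a tree that does not contain
its head. -/
theorem IsInForest.erase {H : Finset E} (h : G.IsInForest H) {e : E} (he : e ∈ H) :
    G.IsInForest (H.erase e) ∧ (∀ e' ∈ H.erase e, G.tail e' ≠ G.tail e) ∧
      ¬ G.InTreeRootedAt (H.erase e) (G.head e) (G.tail e) := by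
  obtain ⟨hH, hr⟩ := isInForest_iff.1 h
  have hsub : H.erase e ⊆ H := Finset.erase_subset e H
  have hH' := hH.mono hsub
  have hi : ∀ e' ∈ H.erase e, G.tail e' ≠ G.tail e := fun e' he' ht =>
    Finset.ne_of_mem_erase he' (hH e' (hsub he') e he ht)
  refine ⟨isInForest_iff.2 ⟨hH', fun v => ?_⟩, hi, fun hc => ?_⟩
  · obtain ⟨r, hvr, hsink⟩ := hr v
    induction hvr using Relation.ReflTransGen.head_induction_on with
    | refl => exact ⟨r, .refl, fun a ha => hsink a (hsub ha)⟩
    | @head a b hab _ ih =>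
      by_cases hae : a = G.tail e
      · subst hae
        exact ⟨_, .refl, hi⟩
      · obtain ⟨s, hs⟩ := ih
        obtain ⟨c, hc, rfl, hb⟩ := hab
        refine ⟨s, .head ⟨c, Finset.mem_erase.2 ⟨?_, hc⟩, rfl, hb⟩ hs.1, hs.2⟩
        rintro rfl
        exact hae rfl
  · rw [hH'.inTreeRootedAt_iff] at hc
    have hstep : G.Step H (G.tail e) (G.head e) := ⟨e, he, rfl, rfl⟩
    have hback : Relation.ReflTransGen (G.Step H) (G.head e) (G.tail e) :=
      reflTransGen_step_mono hsub hc.1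
    obtain ⟨r, hir, hsink⟩ := hr (G.tail e)
    -- `tail e` would lie on a cycle, and unique out-arcs trap every walk from it there, so it
    -- reaches no sink.
    have hri : Relation.ReflTransGen (G.Step H) r (G.tail e) := by
      clear hsink
      induction hir with
      | refl => exact .refl
      | tail _ hbc ih =>
        rcases ih.cases_head with rfl | ⟨d, hbd, hd⟩
        · rwa [hH.step_unique hbc hstep]
        · rwa [hH.step_unique hbc hbd]
    rcases hri.cases_head with rfl | ⟨w, ⟨a, ha, ht, -⟩, -⟩
    · exact hsink e he rfl
    · exact hsink a ha ht

open Classical in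
/-- Sums over in-forests, grouped by the in-forest that remains after the arc at `i` is deleted. -/
theorem sum_isInForest_eq [Fintype E] (i : V) (φ : Finset E → ℝ) :
    ∑ H : Finset E with G.IsInForest H, φ H =
      ∑ H : Finset E with G.IsInForest H ∧ ∀ e ∈ H, G.tail e ≠ i,
        (φ H + ∑ e with G.tail e = i ∧ ¬ G.InTreeRootedAt H (G.head e) i, φ (insert e H)) := by
  rw [Finset.sum_add_distrib, ← Finset.sum_filter_add_sum_filter_not _
    (fun H : Finset E => ∀ e ∈ H, G.tail e ≠ i), Finset.filter_filter, Finset.filter_filter,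
    Finset.sum_sigma']
  congr 1
  symm
  refine Finset.sum_bij (fun p _ => insert p.2 p.1) ?_ ?_ ?_ ?_
  · rintro ⟨H, e⟩ hp
    simp only [Finset.mem_sigma, Finset.mem_filter, Finset.mem_univ, true_and] at hp ⊢
    obtain ⟨⟨hF, hi⟩, rfl, he⟩ := hp
    refine ⟨(hF.insert hi he).1, fun hall => hall e (Finset.mem_insert_self e H) rfl⟩
  · rintro ⟨H, e⟩ hp ⟨H', e'⟩ hp' heq
    simp only [Finset.mem_sigma, Finset.mem_filter, Finset.mem_univ, true_and] at hp hp' heq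
    obtain ⟨⟨hF, hi⟩, rfl, he⟩ := hp
    obtain ⟨⟨hF', hi'⟩, ht, he'⟩ := hp'
    have hee : e = e' := by
      have : e ∈ insert e' H' := heq ▸ Finset.mem_insert_self e H
      rcases Finset.mem_insert.1 this with h | h
      · exact h
      · exact absurd rfl (hi' e h)
    subst hee
    have h1 : e ∉ H := fun h => hi e h rfl
    have h2 : e ∉ H' := fun h => hi' e h rfl
    have : H = H' := by rw [← Finset.erase_insert h1, heq, Finset.erase_insert h2]
    rw [this]
  · intro H hH
    simp only [Finset.mem_filter, Finset.mem_univ, true_and, not_forall, not_not] at hH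
    obtain ⟨hF, e, he, rfl⟩ := hH
    obtain ⟨h1, h2, h3⟩ := hF.erase he
    refine ⟨⟨H.erase e, e⟩, ?_, Finset.insert_erase he⟩
    simp only [Finset.mem_sigma, Finset.mem_filter, Finset.mem_univ, true_and]
    exact ⟨⟨h1, h2⟩, h3⟩
  · intros
    rfl

/-! ### The matrix forest equations -/

variable (G)

open Classical in
/-- The total weight of all in-forests. -/
noncomputable def totalInForestWeight [Fintype E] : ℝ :=
  ∑ H : Finset E with G.IsInForest H, G.subgraphWeight H

theorem subgraphWeight_pos (H : Finset E) : 0 < G.subgraphWeight H :=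
  Finset.prod_pos fun e _ => G.weight_pos e

theorem isInForest_empty : G.IsInForest ∅ :=
  isInForest_iff.2 ⟨by simp [IsFunctional], fun v => ⟨v, .refl, by simp⟩⟩

theorem totalInForestWeight_pos [Fintype E] : 0 < G.totalInForestWeight :=
  Finset.sum_pos (fun H _ => G.subgraphWeight_pos H) ⟨∅, by simp [isInForest_empty]⟩

theorem inForestWeight_self_pos [Fintype E] (j : V) : 0 < G.inForestWeight j j := by
  refine Finset.sum_pos (fun H _ => G.subgraphWeight_pos H) ⟨∅, ?_⟩
  simp only [Finset.mem_filter, Finset.mem_univ, true_and, G.isInForest_empty]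
  rw [IsFunctional.inTreeRootedAt_iff (by simp [IsFunctional])]
  exact ⟨.refl, by simp⟩

open Classical in
theorem inForestWeight_eq_sum_ite [Fintype E] (i j : V) :
    G.inForestWeight i j = ∑ H : Finset E with G.IsInForest H,
      G.subgraphWeight H * if G.InTreeRootedAt H i j then 1 else 0 := by
  simp only [inForestWeight, mul_ite, mul_one, mul_zero]
  rw [← Finset.sum_filter, Finset.filter_filter]

open Classical in
/-- The in-forest weights solve the linear system of the matrix forest theorem. -/
theorem inForestWeight_add_sum [Fintype E] (i k : V) :
    G.inForestWeight i k +
        ∑ e with G.tail e = i, G.weight e * (G.inForestWeight i k - G.inForestWeight (G.head e) k) =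
      G.totalInForestWeight * if i = k then 1 else 0 := by
  set D : ℝ := ∑ e with G.tail e = i, G.weight e with hD
  let χ : Finset E → V → ℝ := fun H v => if G.InTreeRootedAt H v k then 1 else 0
  let δ : ℝ := if i = k then 1 else 0
  -- `c` is the contribution of one forest to the defect of the equation; it cancels within each
  -- group of `sum_isInForest_eq`.
  let c : Finset E → ℝ := fun H =>
    (1 + D) * χ H i - δ - ∑ e with G.tail e = i, G.weight e * χ H (G.head e)
  have hsum : ∑ H : Finset E with G.IsInForest H, G.subgraphWeight H * c H = 0 := by
    rw [sum_isInForest_eq i]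
    refine Finset.sum_eq_zero fun H hH => ?_
    simp only [Finset.mem_filter, Finset.mem_univ, true_and] at hH
    obtain ⟨hF, hi⟩ := hH
    obtain ⟨r, hr⟩ := hF.exists_root
    have hri : r i = i := by
      rw [← hr, (isInForest_iff.1 hF).1.inTreeRootedAt_iff]
      exact ⟨.refl, hi⟩
    set A : Finset E := Finset.univ.filter fun e => G.tail e = i with hA
    have hgood : (Finset.univ.filter fun e => G.tail e = i ∧ ¬ G.InTreeRootedAt H (G.head e) i)
        = A.filter fun e => r (G.head e) ≠ i := by
      rw [hA, Finset.filter_filter]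
      simp only [hr, ne_eq]
    rw [hgood]
    -- Arcs out of `i` have total weight `P` if they leave the tree of `i`, and `B` otherwise; `T`
    -- is the part of `P` entering the tree rooted at `k`.
    set T : ℝ := ∑ e ∈ A with r (G.head e) ≠ i,
      G.weight e * (if r (G.head e) = k then 1 else 0) with hT
    set B : ℝ := ∑ e ∈ A with ¬ r (G.head e) ≠ i, G.weight e with hB
    set P : ℝ := ∑ e ∈ A with r (G.head e) ≠ i, G.weight e with hP
    have hPB : D = P + B := (Finset.sum_filter_add_sum_filter_not A _ _).symm
    have hχ : ∀ v, χ H v = if r v = k then 1 else 0 := fun v => by simp only [χ, hr]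
    have hc : c H = (1 + D) * δ - δ - (T + B * δ) := by
      simp only [c, hχ, hri]
      congr 1
      rw [← Finset.sum_filter_add_sum_filter_not A (fun e => r (G.head e) ≠ i), hB,
        Finset.sum_mul]
      congr 1
      refine Finset.sum_congr rfl fun e he => ?_
      simp only [Finset.mem_filter, not_not] at he
      rw [he.2]
    have hins : ∀ a ∈ A.filter (fun e => r (G.head e) ≠ i),
        G.subgraphWeight (insert a H) * c (insert a H) =
          G.subgraphWeight H * (G.weight a *
            ((1 + P) * (if r (G.head a) = k then 1 else 0) - δ - T)) := by
      intro a ha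
      simp only [hA, Finset.mem_filter, Finset.mem_univ, true_and] at ha
      obtain ⟨rfl, ha⟩ := ha
      have hw : G.subgraphWeight (insert a H) = G.weight a * G.subgraphWeight H :=
        Finset.prod_insert fun h => hi a h rfl
      have hroot := (hF.insert hi (by rwa [hr])).2
      have hχ' : ∀ v, χ (insert a H) v =
          if r v = G.tail a then (if r (G.head a) = k then 1 else 0)
            else if r v = k then 1 else 0 := by
        intro v
        simp only [χ, hroot, hr]
        by_cases hv : r v = G.tail a
        · rw [if_pos hv]
          refine if_congr ⟨?_, fun h => .inr ⟨hv, h⟩⟩ rfl rfl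
          rintro (⟨h1, h2⟩ | h)
          · exact absurd (h1.symm.trans hv) h2
          · exact h.2
        · rw [if_neg hv]
          refine if_congr ⟨?_, fun h => .inl ⟨h, fun h' => hv (h.trans h')⟩⟩ rfl rfl
          rintro (h | h)
          · exact h.1
          · exact absurd h.1 hv
      have hs : ∑ e ∈ A, G.weight e * χ (insert a H) (G.head e) =
          T + B * (if r (G.head a) = k then 1 else 0) := by
        rw [← Finset.sum_filter_add_sum_filter_not A (fun e => r (G.head e) ≠ G.tail a), hB,
          Finset.sum_mul]
        congr 1
        · refine Finset.sum_congr rfl fun e he => ?_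
          rw [hχ', if_neg (Finset.mem_filter.1 he).2]
        · refine Finset.sum_congr rfl fun e he => ?_
          rw [hχ', if_pos (not_not.1 (Finset.mem_filter.1 he).2)]
      have hca : c (insert a H) = (1 + D) * (if r (G.head a) = k then 1 else 0) - δ -
          (T + B * (if r (G.head a) = k then 1 else 0)) := by
        simp only [c]
        rw [hs, hχ', if_pos hri]
      rw [hw, hca, hPB]
      ring
    rw [Finset.sum_congr rfl hins, ← Finset.mul_sum, hc]
    -- The sum is `T - P * δ`, while `c H = P * δ - T`.
    have hlast : ∑ a ∈ A with r (G.head a) ≠ i,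
        G.weight a * ((1 + P) * (if r (G.head a) = k then 1 else 0) - δ - T) =
          (1 + P) * T - P * δ - P * T := by
      rw [hT, Finset.mul_sum, hP, Finset.sum_mul, Finset.sum_mul, ← Finset.sum_sub_distrib,
        ← Finset.sum_sub_distrib]
      refine Finset.sum_congr rfl fun e _ => ?_
      ring
    rw [hlast, hPB]
    ring
  have hexp : ∑ H : Finset E with G.IsInForest H, G.subgraphWeight H * c H =
      (1 + D) * G.inForestWeight i k - G.totalInForestWeight * δ -
        ∑ e with G.tail e = i, G.weight e * G.inForestWeight (G.head e) k := by
    simp only [inForestWeight_eq_sum_ite, totalInForestWeight, Finset.mul_sum, Finset.sum_mul]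
    rw [Finset.sum_comm, ← Finset.sum_sub_distrib, ← Finset.sum_sub_distrib]
    refine Finset.sum_congr rfl fun H _ => ?_
    simp only [c, χ, mul_sub, Finset.mul_sum]
    congr 1
    · ring
    · refine Finset.sum_congr rfl fun e _ => ?_
      ring
  rw [hsum] at hexp
  simp only [mul_sub, Finset.sum_sub_distrib, ← Finset.sum_mul]
  linarith

/-! ### Minimum principle and routes -/

variable {G}

open Classical in
/-- Minimum principle: if at each point of `S` the function `g` is nonnegative or superharmonic
with killing, with all out-neighbours in `S`, then `g` is nonnegative on `S`. -/
theorem nonneg_of_superharmonic [Fintype V] [Fintype E] {g : V → ℝ} {S : Set V}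
    (hout : ∀ v ∈ S, 0 ≤ g v ∨ (∀ e, G.tail e = v → G.head e ∈ S) ∧
      0 ≤ g v + ∑ e with G.tail e = v, G.weight e * (g v - g (G.head e))) :
    ∀ v ∈ S, 0 ≤ g v := by
  intro v₀ hv₀
  obtain ⟨m, hm, hmin⟩ := S.toFinite.exists_minimalFor g S ⟨v₀, hv₀⟩
  have hmin' : ∀ v ∈ S, g m ≤ g v := fun v hv =>
    (le_total (g m) (g v)).elim id fun h => hmin hv h
  refine le_trans ?_ (hmin' v₀ hv₀)
  rcases hout m hm with h | ⟨hS, h⟩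
  · exact h
  -- At a minimizer every Laplacian term is nonpositive, so the killing term alone gives `0 ≤ g m`.
  · have : ∑ e with G.tail e = m, G.weight e * (g m - g (G.head e)) ≤ 0 := by
      refine Finset.sum_nonpos fun e he => ?_
      have hem := hmin' _ (hS e (Finset.mem_filter.1 he).2)
      exact mul_nonpos_of_nonneg_of_nonpos (G.weight_pos e).le (by linarith)
    linarith

/-- Every route can be shortened to a path. -/
theorem Route.exists_isPath {u w : V} (p : G.Route u w) :
    ∃ q : G.Route u w, q.IsPath ∧ q.vertices ⊆ p.vertices := by
  -- Suffixes of a path are paths; this cuts out the loop when a prepended vertex recurs.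
  have drop : ∀ {a b : V} (q : G.Route a b), q.IsPath → ∀ v ∈ q.vertices,
      ∃ q' : G.Route v b, q'.IsPath ∧ q'.vertices ⊆ q.vertices := by
    intro a b q
    induction q with
    | nil a =>
      intro hq v hv
      obtain rfl : v = a := by simpa [Route.vertices] using hv
      exact ⟨.nil v, hq, fun _ h => h⟩
    | @cons a c b e ht hh q ih =>
      intro hq v hv
      rcases List.mem_cons.1 hv with rfl | hv
      · exact ⟨.cons e ht hh q, hq, fun _ h => h⟩
      · obtain ⟨q', h1, h2⟩ := ih (List.nodup_cons.1 hq).2 v hv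
        exact ⟨q', h1, fun x hx => List.mem_cons_of_mem _ (h2 hx)⟩
  induction p with
  | nil v => exact ⟨.nil v, List.nodup_singleton v, fun _ h => h⟩
  | @cons a c b e ht hh p ih =>
    obtain ⟨q, h1, h2⟩ := ih
    by_cases ha : a ∈ q.vertices
    · obtain ⟨q', h3, h4⟩ := drop q h1 a ha
      exact ⟨q', h3, fun x hx => List.mem_cons_of_mem _ (h2 (h4 hx))⟩
    · exact ⟨.cons e ht hh q, List.nodup_cons.2 ⟨ha, h1⟩, List.cons_subset_cons _ h2⟩

end WeightedMultidigraph

/-! ### The inequality and its equality case -/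

theorem theorem1 {V E : Type*} [Fintype V] [Fintype E] (G : WeightedMultidigraph V E)
    (i j k : V) :
    G.inForestWeight i j * G.inForestWeight j k ≤ G.inForestWeight i k * G.inForestWeight j j ∧
    (G.inForestWeight i j * G.inForestWeight j k = G.inForestWeight i k * G.inForestWeight j j ↔
      ∀ p : G.Route i k, p.IsPath → j ∈ p.vertices) := by
  classical
  set g : V → ℝ := fun v =>
    G.inForestWeight v k * G.inForestWeight j j - G.inForestWeight v j * G.inForestWeight j k
    with hg
  have hgj : g j = 0 := by simp only [hg]; ring
  have heq : ∀ v, v ≠ j → g v + ∑ e with G.tail e = v, G.weight e * (g v - g (G.head e)) =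
      G.totalInForestWeight * G.inForestWeight j j * if v = k then 1 else 0 := by
    intro v hv
    have h1 := G.inForestWeight_add_sum v k
    have h2 := G.inForestWeight_add_sum v j
    rw [if_neg hv, mul_zero] at h2
    have h3 : ∑ e with G.tail e = v, G.weight e * (g v - g (G.head e)) =
        (∑ e with G.tail e = v,
          G.weight e * (G.inForestWeight v k - G.inForestWeight (G.head e) k)) *
            G.inForestWeight j j -
        (∑ e with G.tail e = v,
          G.weight e * (G.inForestWeight v j - G.inForestWeight (G.head e) j)) *
            G.inForestWeight j k := by
      rw [Finset.sum_mul, Finset.sum_mul, ← Finset.sum_sub_distrib]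
      refine Finset.sum_congr rfl fun e _ => ?_
      simp only [hg]
      ring
    rw [h3]
    simp only [hg]
    linear_combination G.inForestWeight j j * h1 - G.inForestWeight j k * h2
  have hpos : 0 < G.totalInForestWeight * G.inForestWeight j j :=
    mul_pos G.totalInForestWeight_pos (G.inForestWeight_self_pos j)
  have hnonneg : ∀ v, 0 ≤ g v := by
    refine fun v => WeightedMultidigraph.nonneg_of_superharmonic (G := G) (S := Set.univ)
      (fun v _ => ?_) v trivial
    by_cases hv : v = j
    · exact .inl (hv ▸ hgj.ge)
    · refine .inr ⟨fun _ _ => trivial, ?_⟩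
      rw [heq v hv]
      split_ifs <;> simp [hpos.le]
  -- A zero is a minimum of `g`, so the nonpositive Laplacian sum equals a nonnegative source, and
  -- all terms vanish.
  have key : ∀ v, v ≠ j → g v = 0 → v ≠ k ∧ ∀ e, G.tail e = v → g (G.head e) = 0 := by
    intro v hv h0
    have h := heq v hv
    rw [h0, zero_add] at h
    have hterm : ∀ e ∈ Finset.univ.filter (fun e => G.tail e = v),
        G.weight e * (0 - g (G.head e)) ≤ 0 := fun e _ =>
      mul_nonpos_of_nonneg_of_nonpos (G.weight_pos e).le (by linarith [hnonneg (G.head e)])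
    have hle := Finset.sum_nonpos hterm
    have hvk : v ≠ k := by
      intro hvk
      rw [if_pos hvk, mul_one] at h
      linarith
    rw [if_neg hvk, mul_zero] at h
    refine ⟨hvk, fun e he => ?_⟩
    have := (Finset.sum_eq_zero_iff_of_nonpos hterm).1 h e (by simpa using he)
    simpa [(G.weight_pos e).ne'] using this
  refine ⟨sub_nonneg.1 (hnonneg i), ?_⟩
  rw [eq_comm, ← sub_eq_zero]
  change g i = 0 ↔ _
  constructor
  · intro h0 p _
    have avoid : ∀ {a b : V} (p : G.Route a b), b = k → g a = 0 → j ∈ p.vertices := by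
      intro a b p hb ha
      induction p with
      | nil v =>
        by_contra hj
        have hvj : v ≠ j := fun h => hj (by simp [WeightedMultidigraph.Route.vertices, h])
        exact (key v hvj ha).1 hb
      | @cons a b c e ht hh p ih =>
        by_cases haj : a = j
        · simp [WeightedMultidigraph.Route.vertices, haj]
        · exact List.mem_cons_of_mem _ (ih hb (hh ▸ (key a haj ha).2 e ht))
    exact avoid p rfl h0
  · intro hall
    -- Routes rather than paths make `S` closed under out-arcs away from `j`, since prepending an
    -- arc to a path may repeat a vertex.
    let S : Set V := {v | ∀ p : G.Route v k, j ∈ p.vertices}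
    have hi : i ∈ S := fun p => by
      obtain ⟨q, hq, hqp⟩ := p.exists_isPath
      exact hqp (hall q hq)
    refine le_antisymm ?_ (hnonneg i)
    have := WeightedMultidigraph.nonneg_of_superharmonic (G := G) (S := S) (g := fun v => -g v)
      (fun v hv => ?_) i hi
    · linarith
    · by_cases hvj : v = j
      · left
        rw [hvj, hgj, neg_zero]
      · right
        refine ⟨fun e he p => ?_, ?_⟩
        · refine (List.mem_cons.1 (hv (.cons e he rfl p))).resolve_left ?_
          exact fun h => hvj h.symm
        · have hvk : v ≠ k := by
            rintro rfl
            exact hvj (List.mem_singleton.1 (hv (.nil v))).symm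
          have h := heq v hvj
          rw [if_neg hvk, mul_zero] at h
          have h' : ∑ e with G.tail e = v, G.weight e * (-g v - -g (G.head e)) =
              -∑ e with G.tail e = v, G.weight e * (g v - g (G.head e)) := by
            rw [← Finset.sum_neg_distrib]
            exact Finset.sum_congr rfl fun e _ => by ring
          rw [h']
          linarith
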